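/- All lattices are finite and nonempty; $\hat 0,\hat 1$ denote the least and greatest elements of a lattice $L$, and $x\lessdot y$ means that $y$ covers $x$. **Semidistributive and trim lattices.** $L$ is *semidistributive* if for all $x,y,z\in L$: $x\vee y=x\vee z$ implies $x\vee(y\wedge z)=x\vee y$, and $x\wedge y=x\wedge z$ implies $x\wedge(y\vee z)=x\wedge y$. Let $\mathcal J_L$ be the set of join-irreducible elements (those covering exactly one element, written $j_*$) and $\mathcal M_L$ the set of meet-irreducible elements (those covered by exactly one element, written $m^*$). $L$ is *extremal* if it has a chain $\hat 0=x_0\lessdot x_1\lessdot\cdots\lessdot x_n=\hat 1$ of maximum length among all chains of $L$ with $|\mathcal J_L|=|\mathcal M_L|=n$. An element $x$ is *left modular* if $(y\vee x)\wedge z=y\vee(x\wedge z)$ for all $y\le z$; $L$ is *left modular* if it has a maximal chain of left modular elements; $L$ is *trim* if it is extremal and left modular. **Uniquely paired lattices.** A *pairing* on $L$ is a bijection $\kappa:\mathcal J_L\to\mathcal M_L$ such that for every $j\in\mathcal J_L$ the element $\kappa(j)$ is a maximal element of $\{z\in L: j_*=j\wedge z\}$, and for every $m\in\mathcal M_L$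 the element $\kappa^{-1}(m)$ is a minimal element of $\{z\in L: m^*=m\vee z\}$. $L$ is *uniquely paired* if it has exactly one pairing, denoted $\kappa_L$. Its *Galois graph* $G_L$ is the directed graph on $\mathcal J_L$ with an edge $j\to j'$ if and only if $j\ne j'$ and $j\not\le\kappa_L(j')$. A set of vertices is *independent* if no two of its elements are joined by an edge in either direction. **Compatibly dismantlable lattices** (recursive definition). A uniquely paired lattice $L$ is *compatibly dismantlable* if $|L|=1$, or if there are $j_0,m_0\in L$ such that $L$ is the disjoint union of $[\hat 0,m_0]$ and $[j_0,\hat 1]$ and: - $[j_0,\hat 1]$ is compatibly dismantlable, and $\alpha(j)=j_0\vee j$ defines a bijection $\alpha:\{j\in\mathcal J_L: j_0\le\kappa_L(j)\}\to\mathcal J_{[j_0,\hat 1]}$ with $\kappa_{[j_0,\hat 1]}(\alpha(j))=\kappa_L(j)$ for all $j$ in its domain; - $[\hat 0,m_0]$ is compatibly dismantlable, and $\beta(m)=m_0\wedge m$ defines a bijection $\beta:\{m\in\mathcal M_L:\kappa_L^{-1}(m)\le m_0\}\to\mathcal M_{[\hat 0,m_0]}$ with $\kappa_{[\hat 0,m_0]}^{-1}(\beta(m))=\kappa_L^{-1}(m)$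 for all $m$ in its domain. **Semidistrim lattices.** A uniquely paired lattice $L$ is *overlapping* if for each cover $x\lessdot y$ there is exactly one $j_{xy}\in\mathcal J_L$ with $j_{xy}\le y$ and $\kappa_L(j_{xy})\ge x$. In that case put $\mathcal D_L(x)=\{j_{yx}:y\lessdot x\}$ and $\mathcal U_L(x)=\{j_{xy}:x\lessdot y\}$ for $x\in L$. $L$ is *semidistrim* if it is compatibly dismantlable and overlapping, and for every $x\in L$ the sets $\mathcal D_L(x)$ and $\mathcal U_L(x)$ are independent in $G_L$. **Theorem.** Every finite semidistributive lattice is semidistrim, and every finite trim lattice is semidistrim. -/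

import Mathlib

universe u

namespace SemidistrimLattice

/-! ## Irreducibles and pairings -/

/-- `𝒥_L`: the elements that cover exactly one element. -/
def joinIrr (L : Type u) [Lattice L] : Set L := {j | ∃! a, a ⋖ j}

/-- `ℳ_L`: the elements that are covered by exactly one element. -/
def meetIrr (L : Type u) [Lattice L] : Set L := {m | ∃! b, m ⋖ b}

/-- `j_*`: the unique element covered by the join-irreducible element `j`. -/
noncomputable def lowerCover {L : Type u} [Lattice L] (j : joinIrr L) : L := j.2.choose

/-- `m^*`: the unique element covering the meet-irreducible element `m`. -/
noncomputable def upperCover {L : Type u} [Lattice L] (m : meetIrr L) : L := m.2.choose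

theorem covBy_iff_eq_lowerCover {L : Type u} [Lattice L] (j : joinIrr L) (a : L) :
    a ⋖ (j : L) ↔ a = lowerCover j :=
  ⟨j.2.choose_spec.2 a, fun h => h ▸ j.2.choose_spec.1⟩

theorem covBy_iff_eq_upperCover {L : Type u} [Lattice L] (m : meetIrr L) (b : L) :
    (m : L) ⋖ b ↔ b = upperCover m :=
  ⟨m.2.choose_spec.2 b, fun h => h ▸ m.2.choose_spec.1⟩

/-- `ℳ_L(j)`: the maximal elements of `{z | j_* = j ∧ z}`. -/
def maxSet {L : Type u} [Lattice L] (j : joinIrr L) : Set L :=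
  {m | Maximal (fun z => lowerCover j = (j : L) ⊓ z) m}

/-- `𝒥_L(m)`: the minimal elements of `{z | m^* = m ∨ z}`. -/
def minSet {L : Type u} [Lattice L] (m : meetIrr L) : Set L :=
  {j | Minimal (fun z => upperCover m = (m : L) ⊔ z) j}

/-- A pairing on `L` is a bijection `κ : 𝒥_L → ℳ_L` with `κ(j) ∈ ℳ_L(j)` for all `j` and
`κ⁻¹(m) ∈ 𝒥_L(m)` for all `m`. -/
structure IsPairing {L : Type u} [Lattice L] (κ : joinIrr L ≃ meetIrr L) : Prop where
  map_mem : ∀ j : joinIrr L, (κ j : L) ∈ maxSet j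
  symm_mem : ∀ m : meetIrr L, (κ.symm m : L) ∈ minSet m

/-- `L` has exactly one pairing. -/
def UniquelyPaired (L : Type u) [Lattice L] : Prop :=
  ∃! κ : joinIrr L ≃ meetIrr L, IsPairing κ

/-- `κ_L`: the unique pairing of a uniquely paired lattice. -/
noncomputable def UniquelyPaired.kappa {L : Type u} [Lattice L] (h : UniquelyPaired L) :
    joinIrr L ≃ meetIrr L := h.choose

theorem UniquelyPaired.isPairing_iff {L : Type u} [Lattice L] (h : UniquelyPaired L)
    (κ : joinIrr L ≃ meetIrr L) : IsPairing κ ↔ κ = h.kappa :=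
  ⟨h.choose_spec.2 κ, fun e => e ▸ h.choose_spec.1⟩

/-! ## Galois graphs and independent sets -/

/-- The Galois graph `G_L`: there is an edge `j → j'` when `j ≰ κ_L(j')` and `j ≠ j'`. -/
noncomputable def galoisGraph {L : Type u} [Lattice L] (h : UniquelyPaired L) :
    Digraph (joinIrr L) where
  Adj j j' := ¬ (j : L) ≤ (h.kappa j' : L) ∧ j ≠ j'

/-- No two (distinct) vertices of `I` are joined by an edge, in either direction. -/
def IsIndependent {V : Type u} (G : Digraph V) (I : Set V) : Prop :=
  ∀ a ∈ I, ∀ b ∈ I, a ≠ b → ¬ G.Adj a b ∧ ¬ G.Adj b a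

/-! ## Compatibly dismantlable lattices -/

/-- `(j₀, m₀)` is a prime pair: `L` is the disjoint union of `[0, m₀]` and `[j₀, 1]`. -/
def IsPrimePair {L : Type u} [Lattice L] (j₀ m₀ : L) : Prop :=
  Set.Iic m₀ ∪ Set.Ici j₀ = Set.univ ∧ Disjoint (Set.Iic m₀) (Set.Ici j₀)

/-- The first compatibility condition: `j ↦ j₀ ∨ j` is a bijection `α` from
`{j ∈ 𝒥_L | j₀ ≤ κ_L(j)}` to the join-irreducibles of `[j₀, 1]`, and
`κ_{[j₀, 1]}(α(j)) = κ_L(j)`. -/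
def UpperCompatible {L : Type u} [Lattice L] (h : UniquelyPaired L) (j₀ : L)
    (h' : UniquelyPaired (Set.Ici j₀)) : Prop :=
  ∃ α : {j : joinIrr L // j₀ ≤ (h.kappa j : L)} ≃ joinIrr (Set.Ici j₀),
    (∀ j, ((α j : Set.Ici j₀) : L) = j₀ ⊔ ((j : joinIrr L) : L)) ∧
    ∀ j, ((h'.kappa (α j) : Set.Ici j₀) : L) = (h.kappa (j : joinIrr L) : L)

/-- The second compatibility condition: `m ↦ m₀ ∧ m` is a bijection `β` from
`{m ∈ ℳ_L | κ_L⁻¹(m) ≤ m₀}` to the meet-irreducibles of `[0, m₀]`, and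
`κ_{[0, m₀]}⁻¹(β(m)) = κ_L⁻¹(m)`. -/
def LowerCompatible {L : Type u} [Lattice L] (h : UniquelyPaired L) (m₀ : L)
    (h' : UniquelyPaired (Set.Iic m₀)) : Prop :=
  ∃ β : {m : meetIrr L // (h.kappa.symm m : L) ≤ m₀} ≃ meetIrr (Set.Iic m₀),
    (∀ m, ((β m : Set.Iic m₀) : L) = m₀ ⊓ ((m : meetIrr L) : L)) ∧
    ∀ m, ((h'.kappa.symm (β m) : Set.Iic m₀) : L) = (h.kappa.symm (m : meetIrr L) : L)

/-- A uniquely paired lattice is compatibly dismantlable if it has cardinality `1`, or if it has a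
prime pair `(j₀, m₀)` such that `[j₀, 1]` and `[0, m₀]` are compatibly dismantlable and the two
compatibility conditions hold. (The unique pairedness of the two intervals, which is part of their
being compatibly dismantlable, is named so that their pairings can be referred to.) -/
inductive CompatiblyDismantlable : (L : Type u) → [Lattice L] → Prop
  | single {L : Type u} [Lattice L] (h : UniquelyPaired L) (hcard : Nat.card L = 1) :
      CompatiblyDismantlable L
  | dismantle {L : Type u} [Lattice L] (h : UniquelyPaired L) (j₀ m₀ : L)
      (hprime : IsPrimePair j₀ m₀)
      (hupper : CompatiblyDismantlable (Set.Ici j₀))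
      (hupper' : UniquelyPaired (Set.Ici j₀))
      (hα : UpperCompatible h j₀ hupper')
      (hlower : CompatiblyDismantlable (Set.Iic m₀))
      (hlower' : UniquelyPaired (Set.Iic m₀))
      (hβ : LowerCompatible h m₀ hlower') :
      CompatiblyDismantlable L

theorem CompatiblyDismantlable.uniquelyPaired {L : Type u} [Lattice L]
    (h : CompatiblyDismantlable L) : UniquelyPaired L := by
  cases h <;> assumption

/-! ## Overlapping lattices, label sets and semidistrim lattices -/

/-- For every cover `x ⋖ y` there is exactly one join-irreducible `j` with `κ_L(j) ≥ x` and
`j ≤ y`. -/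
def Overlapping {L : Type u} [Lattice L] (h : UniquelyPaired L) : Prop :=
  ∀ x y : L, x ⋖ y → ∃! j : joinIrr L, x ≤ (h.kappa j : L) ∧ (j : L) ≤ y

/-- The label `j_{xy}` of the cover `x ⋖ y` in an overlapping lattice. -/
noncomputable def Overlapping.label {L : Type u} [Lattice L] {h : UniquelyPaired L}
    (ho : Overlapping h) {x y : L} (hxy : x ⋖ y) : joinIrr L := (ho x y hxy).choose

theorem Overlapping.eq_label_iff {L : Type u} [Lattice L] {h : UniquelyPaired L}
    (ho : Overlapping h) {x y : L} (hxy : x ⋖ y) (j : joinIrr L) :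
    j = ho.label hxy ↔ x ≤ (h.kappa j : L) ∧ (j : L) ≤ y :=
  ⟨fun e => e ▸ (ho x y hxy).choose_spec.1, (ho x y hxy).choose_spec.2 j⟩

/-- The downward label set `𝒟_L(x) = {j_{yx} | y ⋖ x}`. -/
def Overlapping.downLabels {L : Type u} [Lattice L] {h : UniquelyPaired L}
    (ho : Overlapping h) (x : L) : Set (joinIrr L) :=
  {j | ∃ (y : L) (hyx : y ⋖ x), ho.label hyx = j}

/-- The upward label set `𝒰_L(x) = {j_{xy} | x ⋖ y}`. -/
def Overlapping.upLabels {L : Type u} [Lattice L] {h : UniquelyPaired L}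
    (ho : Overlapping h) (x : L) : Set (joinIrr L) :=
  {j | ∃ (y : L) (hxy : x ⋖ y), ho.label hxy = j}

/-- `L` is semidistrim: it is compatibly dismantlable, and (its cover relations being labelled)
all downward and upward label sets are independent sets in the Galois graph. -/
structure IsSemidistrim (L : Type u) [Lattice L] : Prop where
  uniquelyPaired : UniquelyPaired L
  compatiblyDismantlable : CompatiblyDismantlable L
  overlapping : Overlapping uniquelyPaired
  down_independent : ∀ x : L,
    IsIndependent (galoisGraph uniquelyPaired) (overlapping.downLabels x)
  up_independent : ∀ x : L,
    IsIndependent (galoisGraph uniquelyPaired) (overlapping.upLabels x)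

/-! ## Semidistributive lattices and trim lattices -/

/-- `L` is both join-semidistributive and meet-semidistributive. -/
structure IsSemidistributive (L : Type u) [Lattice L] : Prop where
  join : ∀ x y z : L, x ⊔ y = x ⊔ z → x ⊔ (y ⊓ z) = x ⊔ y
  meet : ∀ x y z : L, x ⊓ y = x ⊓ z → x ⊓ (y ⊔ z) = x ⊓ y

/-- `L` has a chain `0 = x₀ ⋖ x₁ ⋖ ⋯ ⋖ xₙ = 1`, of maximum length among all chains of `L`, such
that `|𝒥_L| = |ℳ_L| = n`. -/
def IsExtremal (L : Type u) [Lattice L] : Prop :=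
  ∃ (n : ℕ) (x : Fin (n + 1) → L),
    IsBot (x 0) ∧ IsTop (x (Fin.last n)) ∧
    (∀ i : Fin n, x i.castSucc ⋖ x i.succ) ∧
    (∀ p : LTSeries L, p.length ≤ n) ∧
    Nat.card (joinIrr L) = n ∧ Nat.card (meetIrr L) = n

/-- `x` is a left modular element. -/
def IsLeftModularElement {L : Type u} [Lattice L] (x : L) : Prop :=
  ∀ y z : L, y ≤ z → (y ⊔ x) ⊓ z = y ⊔ (x ⊓ z)

/-- `L` has a maximal chain of left modular elements. -/
def IsLeftModular (L : Type u) [Lattice L] : Prop :=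
  ∃ C : Set L, IsMaxChain (· ≤ ·) C ∧ ∀ x ∈ C, IsLeftModularElement x

/-- `L` is trim: extremal and left modular. -/
structure IsTrim (L : Type u) [Lattice L] : Prop where
  extremal : IsExtremal L
  leftModular : IsLeftModular L

end SemidistrimLattice

namespace SemidistrimLattice

/-! ### Covers of irreducibles and general properties of pairings. -/

section Basic

variable {L : Type u} [Lattice L]

/-! Both halves rest on one principle: a bijection `κ` that gives every cover exactly one label,
with `j ≰ κ j` always, is automatically a pairing (`LabelsCovers.isPairing`). It then remains to
show that no other pairing exists, that the class is closed under passing to intervals with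
compatible pairings and has prime pairs, and that labels around an element are independent.

Semidistributive case. Any pairing matches `j` with an `m` such that `j ≰ m`, `j_* ≤ m` and `j ≤
m^*`. Semidistributivity makes such an `m` the greatest `z` with `j ∧ z = j_*`, and such a `j` the
least `z` with `m ∨ z = m^*`. These extremal descriptions give existence and uniqueness of `κ`, its
behaviour on intervals, and the labels: the label of `x ⋖ y` is the least `z` with `x ∨ z = y`. An
atom and its partner form a prime pair.

Trim case. For `x < y`, a left modular chain has a step `c i, c (i+1)` with `y ∧ c (i+1) ≰ c i` and
`c (i+1) ≰ x ∨ c i` (`exists_last_jump`). Hence no chain is longer than the left modular one, and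
extremality leaves exactly one join- and one meet-irreducible for each of its steps; `κ` pairs these
two. The jump lemmas then produce the labels and the independence. Meeting or joining the chain with
`w` gives such a chain, possibly with repetitions, in `[0, w]` or `[w, 1]`. -/

theorem lowerCover_covBy (j : joinIrr L) : lowerCover j ⋖ (j : L) :=
  (covBy_iff_eq_lowerCover j _).2 rfl

theorem covBy_upperCover (m : meetIrr L) : (m : L) ⋖ upperCover m :=
  (covBy_iff_eq_upperCover m _).2 rfl

theorem mem_joinIrr_of_forall_lt {a b : L} (hb : b < a) (h : ∀ z < a, z ≤ b) : a ∈ joinIrr L := by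
  refine ⟨b, ⟨hb, fun z hz hza => absurd (h z hza) hz.not_ge⟩, fun z hz => ?_⟩
  rcases (h z hz.lt).lt_or_eq with h' | h'
  · exact absurd hb (hz.2 h')
  · exact h'

theorem mem_meetIrr_of_forall_lt {a b : L} (hb : a < b) (h : ∀ z, a < z → b ≤ z) :
    a ∈ meetIrr L := by
  refine ⟨b, ⟨hb, fun z hz hzb => absurd (h z hz) hzb.not_ge⟩, fun z hz => ?_⟩
  rcases (h z hz.lt).lt_or_eq with h' | h'
  · exact absurd h' (hz.2 hb)
  · exact h'.symm

theorem eq_of_covBy_of_lt_of_le {x y z : L} (h : x ⋖ y) (h₁ : x < z) (h₂ : z ≤ y) : z = y :=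
  h₂.eq_of_not_lt (h.2 h₁)

theorem IsPairing.lowerCover_eq {κ : joinIrr L ≃ meetIrr L} (h : IsPairing κ) (j : joinIrr L) :
    lowerCover j = (j : L) ⊓ κ j := (h.map_mem j).1

theorem IsPairing.not_le {κ : joinIrr L ≃ meetIrr L} (h : IsPairing κ) (j : joinIrr L) :
    ¬ (j : L) ≤ κ j := fun h' =>
  (lowerCover_covBy j).ne ((h.lowerCover_eq j).trans (inf_eq_left.2 h'))

theorem IsPairing.lowerCover_le {κ : joinIrr L ≃ meetIrr L} (h : IsPairing κ) (j : joinIrr L) :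
    lowerCover j ≤ (κ j : L) := (h.lowerCover_eq j).trans_le inf_le_right

theorem UniquelyPaired.isPairing_kappa (h : UniquelyPaired L) : IsPairing h.kappa :=
  (h.isPairing_iff _).2 rfl

variable [Finite L]

theorem le_lowerCover_of_lt {j : joinIrr L} {z : L} (h : z < j) : z ≤ lowerCover j := by
  obtain ⟨a, hza, ha⟩ := exists_le_covBy_of_lt h
  rwa [(covBy_iff_eq_lowerCover j a).1 ha] at hza

theorem upperCover_le_of_lt {m : meetIrr L} {z : L} (h : (m : L) < z) : upperCover m ≤ z := by
  obtain ⟨a, ha, haz⟩ := exists_covBy_le_of_lt h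
  rwa [(covBy_iff_eq_upperCover m a).1 ha] at haz

theorem exists_joinIrr_le_not_le {y z : L} (h : ¬ y ≤ z) :
    ∃ j : joinIrr L, (j : L) ≤ y ∧ ¬ (j : L) ≤ z := by
  obtain ⟨a, ha⟩ := (Set.toFinite {a : L | a ≤ y ∧ ¬ a ≤ z}).exists_minimal ⟨y, le_rfl, h⟩
  refine ⟨⟨a, mem_joinIrr_of_forall_lt (b := a ⊓ z) (inf_lt_left.2 ha.1.2) fun b hb => ?_⟩, ha.1⟩
  by_contra hbz
  refine hb.not_ge (ha.2 ⟨hb.le.trans ha.1.1, fun h' => hbz (le_inf hb.le h')⟩ hb.le)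

theorem exists_meetIrr_ge_not_ge {y z : L} (h : ¬ y ≤ z) :
    ∃ m : meetIrr L, z ≤ (m : L) ∧ ¬ y ≤ (m : L) := by
  obtain ⟨a, ha⟩ := (Set.toFinite {a : L | z ≤ a ∧ ¬ y ≤ a}).exists_maximal ⟨z, le_rfl, h⟩
  refine ⟨⟨a, mem_meetIrr_of_forall_lt (b := a ⊔ y) (left_lt_sup.2 ha.1.2) fun b hb => ?_⟩, ha.1⟩
  by_contra hbz
  refine hb.not_ge (ha.2 ⟨ha.1.1.trans hb.le, fun h' => hbz (sup_le hb.le h')⟩ hb.le)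

/-! ## Pairings with unique labels of covers -/

/-- Every cover `x ⋖ y` has exactly one label `j ≤ y` with `x ≤ κ j`, and `j ≰ κ j`. -/
structure LabelsCovers (κ : joinIrr L ≃ meetIrr L) : Prop where
  not_le : ∀ j : joinIrr L, ¬ (j : L) ≤ (κ j : L)
  existsUnique : ∀ x y : L, x ⋖ y → ∃! j : joinIrr L, x ≤ (κ j : L) ∧ (j : L) ≤ y

/-- The label of `j_* ⋖ j` is `j` itself: a label `k < j` would satisfy `k ≤ j_* ≤ κ k`. -/
theorem LabelsCovers.lowerCover_le {κ : joinIrr L ≃ meetIrr L} (h : LabelsCovers κ)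
    (j : joinIrr L) : lowerCover j ≤ (κ j : L) := by
  obtain ⟨k, ⟨h1, h2⟩, -⟩ := h.existsUnique _ _ (lowerCover_covBy j)
  rcases h2.lt_or_eq with h3 | h3
  · exact absurd ((le_lowerCover_of_lt h3).trans h1) (h.not_le k)
  · rwa [Subtype.ext h3] at h1

theorem LabelsCovers.le_upperCover {κ : joinIrr L ≃ meetIrr L} (h : LabelsCovers κ)
    (j : joinIrr L) : (j : L) ≤ upperCover (κ j) := by
  obtain ⟨k, ⟨h1, h2⟩, -⟩ := h.existsUnique _ _ (covBy_upperCover (κ j))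
  rcases h1.lt_or_eq with h3 | h3
  · exact absurd (h2.trans (upperCover_le_of_lt h3)) (h.not_le k)
  · rwa [← κ.injective (Subtype.ext h3)] at h2

theorem LabelsCovers.isPairing {κ : joinIrr L ≃ meetIrr L} (h : LabelsCovers κ) :
    IsPairing κ where
  map_mem j := by
    refine ⟨le_antisymm (le_inf (lowerCover_covBy j).le (h.lowerCover_le j))
      (le_lowerCover_of_lt (inf_lt_left.2 (h.not_le j))), fun z hz hle => ?_⟩
    rcases hle.lt_or_eq with h1 | h1
    · have h2 : (j : L) ≤ z := (h.le_upperCover j).trans (upperCover_le_of_lt h1)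
      exact absurd (hz.trans (inf_eq_left.2 h2)) (lowerCover_covBy j).ne
    · exact h1.ge
  symm_mem m := by
    obtain ⟨j, rfl⟩ := κ.surjective m
    rw [Equiv.symm_apply_apply]
    refine ⟨le_antisymm (upperCover_le_of_lt (left_lt_sup.2 (h.not_le j)))
      (sup_le (covBy_upperCover _).le (h.le_upperCover j)), fun z hz hle => ?_⟩
    rcases hle.lt_or_eq with h1 | h1
    · have h2 : z ≤ (κ j : L) := (le_lowerCover_of_lt h1).trans (h.lowerCover_le j)
      exact absurd (hz.trans (sup_eq_left.2 h2)) (covBy_upperCover _).ne'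
    · exact h1.ge

/-- Otherwise `κ(j)^*` also meets `j` in `j_*`, against the maximality of `κ j`. -/
theorem IsPairing.le_upperCover {κ : joinIrr L ≃ meetIrr L} (h : IsPairing κ) (j : joinIrr L) :
    (j : L) ≤ upperCover (κ j) := by
  by_contra h'
  refine (covBy_upperCover (κ j)).lt.not_ge ((h.map_mem j).2 ?_ (covBy_upperCover (κ j)).le)
  exact le_antisymm (le_inf (lowerCover_covBy j).le
      ((h.lowerCover_le j).trans (covBy_upperCover (κ j)).le))
    (le_lowerCover_of_lt (inf_lt_left.2 h'))

theorem exists_equiv_of_existsUnique {α β : Type*} {R : α → β → Prop}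
    (h₁ : ∀ a, ∃! b, R a b) (h₂ : ∀ b, ∃! a, R a b) : ∃ e : α ≃ β, ∀ a, R a (e a) := by
  choose f hf using fun a => (h₁ a).exists
  refine ⟨Equiv.ofBijective f ⟨fun a a' h => ?_, fun b => ?_⟩, hf⟩
  · exact (h₂ (f a)).unique (hf a) (h ▸ hf a')
  · obtain ⟨a, ha⟩ := (h₂ b).exists
    exact ⟨a, (h₁ a).unique (hf a) ha⟩

/-- One inequality per ordered pair of labels suffices, since exchanging the two covers excludes the
edge in the other direction. -/
theorem isSemidistrim_of_labelsCovers {κ : joinIrr L ≃ meetIrr L} (h : LabelsCovers κ)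
    (huniq : ∀ κ', IsPairing κ' → κ' = κ) (hcd : CompatiblyDismantlable L)
    (hdown : ∀ (x y y' : L) (j j' : joinIrr L), y ⋖ x → y' ⋖ x → j ≠ j' →
      y ≤ κ j → (j : L) ≤ x → y' ≤ κ j' → (j' : L) ≤ x → (j : L) ≤ κ j')
    (hup : ∀ (x y y' : L) (j j' : joinIrr L), x ⋖ y → x ⋖ y' → j ≠ j' →
      x ≤ κ j → (j : L) ≤ y → x ≤ κ j' → (j' : L) ≤ y' → (j : L) ≤ κ j') :
    IsSemidistrim L := by
  have hU : UniquelyPaired L := ⟨κ, h.isPairing, huniq⟩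
  have hκ : hU.kappa = κ := huniq _ hU.isPairing_kappa
  have ho : Overlapping hU := by
    intro x y hxy
    rw [hκ]
    exact h.existsUnique x y hxy
  refine ⟨hU, hcd, ho, fun x => ?_, fun x => ?_⟩
  · rintro a ⟨y, hy, hya⟩ b ⟨z, hz, hzb⟩ hab
    have h1 := (ho.eq_label_iff hy a).1 hya.symm
    have h2 := (ho.eq_label_iff hz b).1 hzb.symm
    rw [hκ] at h1 h2
    simp only [galoisGraph, hκ, not_and_or, not_not]
    exact ⟨.inl (hdown x y z a b hy hz hab h1.1 h1.2 h2.1 h2.2),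
      .inl (hdown x z y b a hz hy hab.symm h2.1 h2.2 h1.1 h1.2)⟩
  · rintro a ⟨y, hy, hya⟩ b ⟨z, hz, hzb⟩ hab
    have h1 := (ho.eq_label_iff hy a).1 hya.symm
    have h2 := (ho.eq_label_iff hz b).1 hzb.symm
    rw [hκ] at h1 h2
    simp only [galoisGraph, hκ, not_and_or, not_not]
    exact ⟨.inl (hup x y z a b hy hz hab h1.1 h1.2 h2.1 h2.2),
      .inl (hup x z y b a hz hy hab.symm h2.1 h2.2 h1.1 h1.2)⟩

end Basic

/-! ## Irreducibles of intervals -/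

section Intervals

variable {L : Type u} [Lattice L]

theorem Iic_covBy_iff {w : L} {a b : Set.Iic w} : a ⋖ b ↔ (a : L) ⋖ (b : L) := by
  refine ⟨fun h => ⟨h.1, fun z hz hzb => ?_⟩, fun h => ⟨h.1, fun z hz hzb => h.2 hz hzb⟩⟩
  exact h.2 (c := ⟨z, hzb.le.trans b.2⟩) hz hzb

theorem Ici_covBy_iff {w : L} {a b : Set.Ici w} : a ⋖ b ↔ (a : L) ⋖ (b : L) := by
  refine ⟨fun h => ⟨h.1, fun z hz hzb => ?_⟩, fun h => ⟨h.1, fun z hz hzb => h.2 hz hzb⟩⟩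
  exact h.2 (c := ⟨z, le_trans a.2 hz.le⟩) hz hzb

theorem mem_joinIrr_Iic_iff {w : L} {a : Set.Iic w} : a ∈ joinIrr (Set.Iic w) ↔
    (a : L) ∈ joinIrr L := by
  constructor
  · rintro ⟨b, hb, hu⟩
    exact ⟨b, Iic_covBy_iff.1 hb, fun z hz =>
      congrArg Subtype.val (hu ⟨z, hz.le.trans a.2⟩ (Iic_covBy_iff.2 hz))⟩
  · rintro ⟨b, hb, hu⟩
    exact ⟨⟨b, hb.le.trans a.2⟩, Iic_covBy_iff.2 hb, fun z hz =>
      Subtype.ext (hu z (Iic_covBy_iff.1 hz))⟩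

theorem mem_meetIrr_Ici_iff {w : L} {a : Set.Ici w} : a ∈ meetIrr (Set.Ici w) ↔
    (a : L) ∈ meetIrr L := by
  constructor
  · rintro ⟨b, hb, hu⟩
    exact ⟨b, Ici_covBy_iff.1 hb, fun z hz =>
      congrArg Subtype.val (hu ⟨z, le_trans a.2 hz.le⟩ (Ici_covBy_iff.2 hz))⟩
  · rintro ⟨b, hb, hu⟩
    exact ⟨⟨b, le_trans a.2 hb.le⟩, Ici_covBy_iff.2 hb, fun z hz =>
      Subtype.ext (hu z (Ici_covBy_iff.1 hz))⟩

/-- The join-irreducibles of `[0, w]` are those of `L` below `w`. -/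
def joinIrrIicEquiv (w : L) : {j : joinIrr L // (j : L) ≤ w} ≃ joinIrr (Set.Iic w) where
  toFun j := ⟨⟨j.1.1, j.2⟩, mem_joinIrr_Iic_iff.2 j.1.2⟩
  invFun j := ⟨⟨j.1.1, mem_joinIrr_Iic_iff.1 j.2⟩, j.1.2⟩
  left_inv _ := rfl
  right_inv _ := rfl

/-- The meet-irreducibles of `[w, 1]` are those of `L` above `w`. -/
def meetIrrIciEquiv (w : L) : {m : meetIrr L // w ≤ (m : L)} ≃ meetIrr (Set.Ici w) where
  toFun m := ⟨⟨m.1.1, m.2⟩, mem_meetIrr_Ici_iff.2 m.1.2⟩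
  invFun m := ⟨⟨m.1.1, mem_meetIrr_Ici_iff.1 m.2⟩, m.1.2⟩
  left_inv _ := rfl
  right_inv _ := rfl

/-- The join-irreducibles of `[0, w]` are those of `L` below `w`, so conjugating by the two pairings
gives the bijection `β`; only the formula `κ_{[0,w]}(j) = w ∧ κ(j)` has to be checked. -/
theorem lowerCompatible_of_kappa_eq (h : UniquelyPaired L) (w : L)
    (h' : UniquelyPaired (Set.Iic w))
    (key : ∀ j : {j : joinIrr L // (j : L) ≤ w},
      ((h'.kappa (joinIrrIicEquiv w j) : Set.Iic w) : L) = w ⊓ (h.kappa j.1 : L)) :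
    LowerCompatible h w h' := by
  let e : {m : meetIrr L // (h.kappa.symm m : L) ≤ w} ≃ {j : joinIrr L // (j : L) ≤ w} :=
    h.kappa.symm.subtypeEquiv fun _ => Iff.rfl
  refine ⟨(e.trans (joinIrrIicEquiv w)).trans h'.kappa, fun m => ?_, fun m => ?_⟩
  · have := key (e m)
    rw [show (e m).1 = h.kappa.symm m.1 from rfl, Equiv.apply_symm_apply] at this
    exact this
  · rw [Equiv.trans_apply, Equiv.symm_apply_apply]
    rfl

theorem upperCompatible_of_kappa_symm_eq (h : UniquelyPaired L) (w : L)
    (h' : UniquelyPaired (Set.Ici w))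
    (key : ∀ m : {m : meetIrr L // w ≤ (m : L)},
      ((h'.kappa.symm (meetIrrIciEquiv w m) : Set.Ici w) : L) = w ⊔ (h.kappa.symm m.1 : L)) :
    UpperCompatible h w h' := by
  let e : {j : joinIrr L // w ≤ (h.kappa j : L)} ≃ {m : meetIrr L // w ≤ (m : L)} :=
    h.kappa.subtypeEquiv fun _ => Iff.rfl
  refine ⟨(e.trans (meetIrrIciEquiv w)).trans h'.kappa.symm, fun m => ?_, fun m => ?_⟩
  · have := key (e m)
    rw [show (e m).1 = h.kappa m.1 from rfl, Equiv.symm_apply_apply] at this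
    exact this
  · rw [Equiv.trans_apply, Equiv.apply_symm_apply]
    rfl

theorem isPrimePair_of_le_iff {j m : L} (h : ∀ y : L, y ≤ m ↔ ¬ j ≤ y) : IsPrimePair j m := by
  refine ⟨Set.eq_univ_of_forall fun y => ?_, Set.disjoint_left.2 fun y hy hy' => ?_⟩
  · by_cases hy : j ≤ y
    · exact .inr hy
    · exact .inl ((h y).2 hy)
  · exact (h y).1 hy hy'

end Intervals

/-- A class of uniquely paired lattices closed under a compatible dismantling step consists of
compatibly dismantlable lattices. -/
theorem compatiblyDismantlable_of_closed (P : ∀ (L : Type u) [Lattice L], Prop)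
    (hU : ∀ (L : Type u) [Lattice L] [Finite L] [Nonempty L], P L → UniquelyPaired L)
    (hstep : ∀ (L : Type u) [Lattice L] [Finite L] [Nontrivial L], P L →
      ∃ j₀ m₀ : L, IsPrimePair j₀ m₀ ∧ P (Set.Ici j₀) ∧ P (Set.Iic m₀) ∧
        (∀ h h', UpperCompatible h j₀ h') ∧ ∀ h h', LowerCompatible h m₀ h')
    (L : Type u) [Lattice L] [Finite L] [Nonempty L] (hL : P L) : CompatiblyDismantlable L := by
  suffices H : ∀ (n : ℕ) (L : Type u) [Lattice L] [Finite L] [Nonempty L], Nat.card L = n →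
      P L → CompatiblyDismantlable L from H _ L rfl hL
  clear hL
  intro n
  induction n using Nat.strong_induction_on with
  | _ n ih =>
    intro L _ _ _ hn hL
    rcases subsingleton_or_nontrivial L with hs | hnt
    · exact .single (hU L hL) (Nat.card_eq_one_iff_unique.2 ⟨hs, inferInstance⟩)
    · obtain ⟨j₀, m₀, hp, h1, h2, h3, h4⟩ := hstep L hL
      have hdis : ¬ j₀ ≤ m₀ := fun h => Set.disjoint_left.1 hp.2 (Set.mem_Iic.2 h) le_rfl
      have : Nonempty (Set.Ici j₀) := ⟨⟨j₀, le_rfl⟩⟩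
      have : Nonempty (Set.Iic m₀) := ⟨⟨m₀, le_rfl⟩⟩
      have c1 : Nat.card (Set.Ici j₀) < n := hn ▸ Finite.card_subtype_lt (x := m₀) hdis
      have c2 : Nat.card (Set.Iic m₀) < n := hn ▸ Finite.card_subtype_lt (x := j₀) hdis
      exact .dismantle (hU L hL) j₀ m₀ hp (ih _ c1 _ rfl h1) (hU _ h1) (h3 _ _)
        (ih _ c2 _ rfl h2) (hU _ h2) (h4 _ _)

/-! ## Semidistributive lattices -/

section Semidistributive

variable {L : Type u} [Lattice L]

theorem IsSemidistributive.Iic (h : IsSemidistributive L) (w : L) :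
    IsSemidistributive (Set.Iic w) where
  join x y z e := Subtype.ext (h.join x y z (congrArg Subtype.val e))
  meet x y z e := Subtype.ext (h.meet x y z (congrArg Subtype.val e))

theorem IsSemidistributive.Ici (h : IsSemidistributive L) (w : L) :
    IsSemidistributive (Set.Ici w) where
  join x y z e := Subtype.ext (h.join x y z (congrArg Subtype.val e))
  meet x y z e := Subtype.ext (h.meet x y z (congrArg Subtype.val e))

/-- The relation between `j` and `κ j` in any pairing. -/
structure Matched (j : joinIrr L) (m : meetIrr L) : Prop where
  not_le : ¬ (j : L) ≤ m
  lowerCover_le : lowerCover j ≤ (m : L)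
  le_upperCover : (j : L) ≤ upperCover m

variable [Finite L]

theorem IsPairing.matched {κ : joinIrr L ≃ meetIrr L} (h : IsPairing κ) (j : joinIrr L) :
    Matched j (κ j) := ⟨h.not_le j, h.lowerCover_le j, h.le_upperCover j⟩

/-- If `z ≰ m`, then `j ≤ m^* ≤ m ∨ z`, while meet-semidistributivity gives `j ∧ (m ∨ z) = j_*`. So
`m` is the greatest element meeting `j` in `j_*`. -/
theorem Matched.le_of_inf_le (hL : IsSemidistributive L) {j : joinIrr L} {m : meetIrr L}
    (h : Matched j m) {z : L} (h1 : (j : L) ⊓ z = lowerCover j) : z ≤ m := by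
  by_contra hz
  have h2 : (j : L) ⊓ m = lowerCover j := le_antisymm
    (le_lowerCover_of_lt (inf_lt_left.2 h.not_le)) (le_inf (lowerCover_covBy j).le h.lowerCover_le)
  have h3 := hL.meet j m z (h2.trans h1.symm)
  have h4 : (j : L) ≤ (m : L) ⊔ z := h.le_upperCover.trans (upperCover_le_of_lt (left_lt_sup.2 hz))
  rw [inf_eq_left.2 h4, h2] at h3
  exact (lowerCover_covBy j).ne h3.symm

theorem Matched.le_of_sup_eq (hL : IsSemidistributive L) {j : joinIrr L} {m : meetIrr L}
    (h : Matched j m) {z : L} (h1 : (m : L) ⊔ z = upperCover m) : (j : L) ≤ z := by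
  by_contra hz
  have h2 : (m : L) ⊔ j = upperCover m := le_antisymm
    (sup_le (covBy_upperCover m).le h.le_upperCover) (upperCover_le_of_lt (left_lt_sup.2 h.not_le))
  have h3 := hL.join m j z (h2.trans h1.symm)
  have h4 : (j : L) ⊓ z ≤ m := (le_lowerCover_of_lt (inf_lt_left.2 hz)).trans h.lowerCover_le
  rw [sup_eq_left.2 h4, h2] at h3
  exact (covBy_upperCover m).ne h3

theorem IsSemidistributive.existsUnique_meetIrr (hL : IsSemidistributive L) (j : joinIrr L) :
    ∃! m : meetIrr L, Matched j m := by
  obtain ⟨m, hm⟩ := (Set.toFinite {z : L | lowerCover j ≤ z ∧ ¬ (j : L) ≤ z}).exists_maximal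
    ⟨lowerCover j, le_rfl, (lowerCover_covBy j).lt.not_ge⟩
  have hj : ∀ z, m < z → (j : L) ≤ z := fun z hz => by
    by_contra h
    exact hz.not_ge (hm.2 ⟨hm.1.1.trans hz.le, h⟩ hz.le)
  have hmi : m ∈ meetIrr L := mem_meetIrr_of_forall_lt (b := m ⊔ j) (left_lt_sup.2 hm.1.2)
    fun z hz => sup_le hz.le (hj z hz)
  have key : ∀ m : meetIrr L, Matched j m → (j : L) ⊓ m = lowerCover j := fun m h =>
    le_antisymm (le_lowerCover_of_lt (inf_lt_left.2 h.not_le))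
      (le_inf (lowerCover_covBy j).le h.lowerCover_le)
  refine ⟨⟨m, hmi⟩, ⟨hm.1.2, hm.1.1, hj _ (covBy_upperCover ⟨m, hmi⟩).lt⟩, fun m' hm' => ?_⟩
  have h0 : Matched j ⟨m, hmi⟩ := ⟨hm.1.2, hm.1.1, hj _ (covBy_upperCover ⟨m, hmi⟩).lt⟩
  exact Subtype.ext (le_antisymm (h0.le_of_inf_le hL (key _ hm')) (hm'.le_of_inf_le hL (key _ h0)))

theorem IsSemidistributive.existsUnique_joinIrr (hL : IsSemidistributive L) (m : meetIrr L) :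
    ∃! j : joinIrr L, Matched j m := by
  obtain ⟨j, hj⟩ := (Set.toFinite {z : L | z ≤ upperCover m ∧ ¬ z ≤ m}).exists_minimal
    ⟨upperCover m, le_rfl, (covBy_upperCover m).lt.not_ge⟩
  have hm : ∀ z, z < j → z ≤ m := fun z hz => by
    by_contra h
    exact hz.not_ge (hj.2 ⟨hz.le.trans hj.1.1, h⟩ hz.le)
  have hji : j ∈ joinIrr L := mem_joinIrr_of_forall_lt (b := j ⊓ m) (inf_lt_left.2 hj.1.2)
    fun z hz => le_inf hz.le (hm z hz)
  have key : ∀ j : joinIrr L, Matched j m → (m : L) ⊔ j = upperCover m := fun j h =>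
    le_antisymm (sup_le (covBy_upperCover m).le h.le_upperCover)
      (upperCover_le_of_lt (left_lt_sup.2 h.not_le))
  have h0 : Matched ⟨j, hji⟩ m := ⟨hj.1.2, hm _ (lowerCover_covBy ⟨j, hji⟩).lt, hj.1.1⟩
  exact ⟨⟨j, hji⟩, h0, fun j' hj' => Subtype.ext
    (le_antisymm (hj'.le_of_sup_eq hL (key _ h0)) (h0.le_of_sup_eq hL (key _ hj')))⟩

/-- The least element of `{z | x ∨ z = y}` is a label of the cover `x ⋖ y`. -/
theorem IsSemidistributive.exists_label (hL : IsSemidistributive L)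
    {κ : joinIrr L ≃ meetIrr L} (hκ : ∀ j, Matched j (κ j)) {x y : L} (hxy : x ⋖ y) :
    ∃ j : joinIrr L, x ≤ κ j ∧ (j : L) ≤ y ∧ ∀ z, x ⊔ z = y → (j : L) ≤ z := by
  obtain ⟨j, hj⟩ := (Set.toFinite {z : L | z ≤ y ∧ ¬ z ≤ x}).exists_minimal
    ⟨y, le_rfl, hxy.lt.not_ge⟩
  have hm : ∀ z, z < j → z ≤ x := fun z hz => by
    by_contra h
    exact hz.not_ge (hj.2 ⟨hz.le.trans hj.1.1, h⟩ hz.le)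
  have hji : j ∈ joinIrr L := mem_joinIrr_of_forall_lt (b := j ⊓ x) (inf_lt_left.2 hj.1.2)
    fun z hz => le_inf hz.le (hm z hz)
  refine ⟨⟨j, hji⟩, (hκ _).le_of_inf_le hL (le_antisymm ?_ (le_inf ?_ ?_)), hj.1.1,
    fun z hz => ?_⟩
  · exact le_lowerCover_of_lt (j := ⟨j, hji⟩) (inf_lt_left.2 hj.1.2)
  · exact (lowerCover_covBy ⟨j, hji⟩).le
  · exact hm _ (lowerCover_covBy ⟨j, hji⟩).lt
  -- By minimality of `j`, `j ∧ z < j` forces `j ∧ z ≤ x`, and join-semidistributivity then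
  -- collapses `y` to `x`.
  · by_contra h
    have h2 : x ⊔ j = y := eq_of_covBy_of_lt_of_le hxy (left_lt_sup.2 hj.1.2) (sup_le hxy.le hj.1.1)
    have h3 := hL.join x j z (h2.trans hz.symm)
    have h4 : j ⊓ z ≤ x := hm _ (inf_lt_left.2 h)
    rw [sup_eq_left.2 h4, h2] at h3
    exact hxy.ne h3

theorem IsSemidistributive.labelsCovers (hL : IsSemidistributive L)
    {κ : joinIrr L ≃ meetIrr L} (hκ : ∀ j, Matched j (κ j)) : LabelsCovers κ where
  not_le j := (hκ j).not_le
  existsUnique x y hxy := by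
    obtain ⟨j, h1, h2, h3⟩ := hL.exists_label hκ hxy
    refine ⟨j, ⟨h1, h2⟩, fun j' ⟨h4, h5⟩ => ?_⟩
    have h6 : ¬ (j' : L) ≤ x := fun h => (hκ j').not_le (h.trans h4)
    have h7 : x ⊔ j' = y := eq_of_covBy_of_lt_of_le hxy (left_lt_sup.2 h6) (sup_le hxy.le h5)
    -- If `j < j'`, then `j ≤ j'_* ≤ κ j'`, so `j' ≤ y = x ∨ j ≤ κ j'`, which is impossible.
    rcases (h3 _ h7).lt_or_eq with h8 | h8
    · have h9 : x ⊔ j = y := eq_of_covBy_of_lt_of_le hxy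
        (left_lt_sup.2 fun h => (hκ j).not_le (h.trans h1)) (sup_le hxy.le h2)
      refine absurd (h5.trans ?_) (hκ j').not_le
      rw [← h9]
      exact sup_le h4 ((le_lowerCover_of_lt h8).trans (hκ j').lowerCover_le)
    · exact Subtype.ext h8.symm

theorem IsSemidistributive.exists_kappa (hL : IsSemidistributive L) :
    ∃ κ : joinIrr L ≃ meetIrr L, LabelsCovers κ ∧ (∀ j, Matched j (κ j)) ∧
      ∀ κ', IsPairing κ' → κ' = κ := by
  obtain ⟨κ, hκ⟩ := exists_equiv_of_existsUnique hL.existsUnique_meetIrr hL.existsUnique_joinIrr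
  exact ⟨κ, hL.labelsCovers hκ, hκ, fun κ' h' => Equiv.ext fun j =>
    (hL.existsUnique_meetIrr j).unique (h'.matched j) (hκ j)⟩

theorem IsSemidistributive.uniquelyPaired (hL : IsSemidistributive L) : UniquelyPaired L := by
  obtain ⟨κ, h, -, h'⟩ := hL.exists_kappa
  exact ⟨κ, h.isPairing, h'⟩

/-- The partner of `j` in `[0, w]` lies below `κ j`, the greatest element meeting `j` in `j_*`; as
`w ∧ κ j` also meets `j` in `j_*`, maximality gives equality. -/
theorem IsSemidistributive.lowerCompatible (hL : IsSemidistributive L) (w : L)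
    (h : UniquelyPaired L) (h' : UniquelyPaired (Set.Iic w)) : LowerCompatible h w h' := by
  refine lowerCompatible_of_kappa_eq h w h' fun j => ?_
  have h1 := h'.isPairing_kappa.map_mem (joinIrrIicEquiv w j)
  have hl : ((lowerCover (joinIrrIicEquiv w j) : Set.Iic w) : L) = lowerCover j.1 :=
    (covBy_iff_eq_lowerCover j.1 _).1 (Iic_covBy_iff.1 (lowerCover_covBy (joinIrrIicEquiv w j)))
  have h2 : (j.1 : L) ⊓ (h'.kappa (joinIrrIicEquiv w j) : Set.Iic w) = lowerCover j.1 :=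
    (congrArg Subtype.val h1.1).symm.trans hl
  have h3 := (h.isPairing_kappa.matched j.1).le_of_inf_le hL h2
  have h4 := le_inf (h'.kappa (joinIrrIicEquiv w j)).1.2 h3
  refine le_antisymm h4 (h1.2 (y := ⟨w ⊓ h.kappa j.1, inf_le_left⟩) (Subtype.ext ?_) h4)
  refine hl.trans ((h.isPairing_kappa.lowerCover_eq j.1).trans ?_)
  change _ = (j.1 : L) ⊓ (w ⊓ h.kappa j.1)
  rw [← inf_assoc, inf_eq_left.2 j.2]

theorem IsSemidistributive.upperCompatible (hL : IsSemidistributive L) (w : L)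
    (h : UniquelyPaired L) (h' : UniquelyPaired (Set.Ici w)) : UpperCompatible h w h' := by
  refine upperCompatible_of_kappa_symm_eq h w h' fun m => ?_
  have h1 := h'.isPairing_kappa.symm_mem (meetIrrIciEquiv w m)
  have hl : ((upperCover (meetIrrIciEquiv w m) : Set.Ici w) : L) = upperCover m.1 :=
    (covBy_iff_eq_upperCover m.1 _).1 (Ici_covBy_iff.1 (covBy_upperCover (meetIrrIciEquiv w m)))
  have h2 : (m.1 : L) ⊔ (h'.kappa.symm (meetIrrIciEquiv w m) : Set.Ici w) = upperCover m.1 :=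
    (congrArg Subtype.val h1.1).symm.trans hl
  have hm := h.isPairing_kappa.matched (h.kappa.symm m.1)
  rw [Equiv.apply_symm_apply] at hm
  have h3 := hm.le_of_sup_eq hL h2
  have h4 := sup_le (h'.kappa.symm (meetIrrIciEquiv w m)).1.2 h3
  refine le_antisymm (h1.2 (y := ⟨w ⊔ h.kappa.symm m.1, le_sup_left⟩) (Subtype.ext ?_) h4) h4
  refine hl.trans ((h.isPairing_kappa.symm_mem m.1).1.trans ?_)
  change _ = (m.1 : L) ⊔ (w ⊔ h.kappa.symm m.1)
  rw [← sup_assoc, sup_eq_left.2 m.2]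

/-- For an atom `a`, every `z ≱ a` satisfies `a ∧ z = 0 = a_*`, so the partner of `a` is the
greatest element not above `a`. -/
theorem IsSemidistributive.exists_primePair [Nontrivial L] (hL : IsSemidistributive L) :
    ∃ j₀ m₀ : L, IsPrimePair j₀ m₀ := by
  obtain ⟨b, hb⟩ : ∃ b : L, IsBot b := by
    obtain ⟨b, hb⟩ := Finite.exists_min (fun x : L => (Set.Iic x).ncard)
    refine ⟨b, fun y => ?_⟩
    by_contra h
    exact absurd (hb (b ⊓ y)) (not_le.2 (Set.ncard_lt_ncard
      (Set.Iic_ssubset_Iic.2 (inf_lt_left.2 h))))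
  obtain ⟨t, ht⟩ := exists_ne b
  obtain ⟨a, ha, -⟩ := exists_covBy_le_of_lt ((hb t).lt_of_ne' ht)
  have hz : ∀ z, ¬ a ≤ z → a ⊓ z = b := fun z h =>
    (((hb _).lt_or_eq).resolve_left fun h' => ha.2 h' (inf_lt_left.2 h)).symm
  have haj : a ∈ joinIrr L := mem_joinIrr_of_forall_lt ha.lt fun z h => by
    rw [← hz z h.not_ge]
    exact le_inf h.le le_rfl
  obtain ⟨m, hm, -⟩ := hL.existsUnique_meetIrr ⟨a, haj⟩
  have hl : b = lowerCover ⟨a, haj⟩ := (covBy_iff_eq_lowerCover ⟨a, haj⟩ b).1 ha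
  exact ⟨a, m, isPrimePair_of_le_iff fun y => ⟨fun h h' => hm.not_le (h'.trans h),
    fun h => hm.le_of_inf_le hL ((hz y h).trans hl)⟩⟩

theorem IsSemidistributive.isSemidistrim [Nonempty L] (hL : IsSemidistributive L) :
    IsSemidistrim L := by
  obtain ⟨κ, h, hκ, hu⟩ := hL.exists_kappa
  refine isSemidistrim_of_labelsCovers h hu (compatiblyDismantlable_of_closed
    (fun L _ => IsSemidistributive L) (fun L _ _ _ h => h.uniquelyPaired) (fun L _ _ _ h => ?_)
    L hL) ?_ ?_
  · obtain ⟨j, m, hp⟩ := h.exists_primePair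
    exact ⟨j, m, hp, h.Ici j, h.Iic m, h.upperCompatible j, h.lowerCompatible m⟩
  · intro x y y' j j' hy hy' hne h1 h2 h3 h4
    obtain ⟨k, hk1, hk2, hk3⟩ := hL.exists_label hκ hy
    obtain rfl := (h.existsUnique y x hy).unique ⟨h1, h2⟩ ⟨hk1, hk2⟩
    -- Here `y ∨ y' = x`, so the least-element property of the label gives `j ≤ y' ≤ κ j'`.
    refine (hk3 y' ?_).trans h3
    refine eq_of_covBy_of_lt_of_le hy (left_lt_sup.2 fun h' => ?_) (sup_le hy.le hy'.le)
    rcases h'.lt_or_eq with h' | h'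
    · exact hy'.2 h' hy.lt
    · subst h'
      exact hne ((h.existsUnique _ x hy).unique ⟨h1, h2⟩ ⟨h3, h4⟩)
  · intro x y y' j j' hy hy' hne h1 h2 h3 h4
    -- It suffices that `y` meets `j'` in `j'_*`, for then `j ≤ y ≤ κ j'`.
    refine h2.trans ((hκ j').le_of_inf_le hL ?_)
    have hyy : y' ⊓ y ≤ x := by
      by_contra h'
      have e : x ⊔ (y' ⊓ y) = y' := eq_of_covBy_of_lt_of_le hy' (left_lt_sup.2 h')
        (sup_le hy'.le inf_le_left)
      have e' : x ⊔ (y' ⊓ y) = y := eq_of_covBy_of_lt_of_le hy (left_lt_sup.2 h')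
        (sup_le hy.le inf_le_right)
      obtain rfl := e.symm.trans e'
      exact hne ((h.existsUnique x _ hy).unique ⟨h1, h2⟩ ⟨h3, h4⟩)
    refine le_antisymm (le_lowerCover_of_lt (inf_lt_left.2 fun h' => ?_))
      (le_inf (lowerCover_covBy j').le ?_)
    · exact (hκ j').not_le (((le_inf h4 h').trans hyy).trans h3)
    · by_contra h'
      have e : x ⊔ lowerCover j' = y' := eq_of_covBy_of_lt_of_le hy'
        (left_lt_sup.2 fun h'' => h' (h''.trans hy.le))
        (sup_le hy'.le ((lowerCover_covBy j').le.trans h4))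
      exact (hκ j').not_le ((h4.trans_eq e.symm).trans (sup_le h3 (hκ j').lowerCover_le))

end Semidistributive

/-! ## Trim lattices -/

theorem exists_not_and_succ {p : ℕ → Prop} (h0 : ¬ p 0) (hN : ∃ n, p n) :
    ∃ n, ¬ p n ∧ p (n + 1) := by
  classical
  obtain ⟨n, hn⟩ : ∃ n, Nat.find hN = n + 1 :=
    Nat.exists_eq_succ_of_ne_zero fun h => h0 (h ▸ Nat.find_spec hN)
  exact ⟨n, Nat.find_min hN (hn ▸ n.lt_succ_self), hn ▸ Nat.find_spec hN⟩

/-! ### Jumps along a left modular chain. -/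

section LeftModular

variable {L : Type u} [Lattice L] {c : ℕ → L}

/-- Take `i` where `x ∨ c i` first rises above `y` at the next step. Left modularity gives `y = x ∨
(y ∧ c (i+1))`, so `y ∧ c (i+1) ≤ c i` would put `y` below `x ∨ c i` too early. -/
theorem exists_last_jump (hbot : IsBot (c 0)) (htop : ∃ n, IsTop (c n))
    (hlm : ∀ i, IsLeftModularElement (c i)) {x y : L} (hxy : x < y) :
    ∃ i, ¬ y ≤ x ⊔ c i ∧ y ≤ x ⊔ c (i + 1) ∧ ¬ y ⊓ c (i + 1) ≤ c i ∧ ¬ c (i + 1) ≤ x ⊔ c i := by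
  obtain ⟨i, h1, h2⟩ := exists_not_and_succ (p := fun i => y ≤ x ⊔ c i)
    (fun h => hxy.not_ge (h.trans (sup_le le_rfl (hbot x))))
    (htop.imp fun n hn => (hn y).trans le_sup_right)
  refine ⟨i, h1, h2, fun h => h1 ?_, fun h => h1 (h2.trans (sup_le le_sup_left h))⟩
  calc y = (x ⊔ c (i + 1)) ⊓ y := (inf_eq_right.2 h2).symm
    _ = x ⊔ y ⊓ c (i + 1) := by rw [hlm _ x y hxy.le, inf_comm]
    _ ≤ x ⊔ c i := sup_le_sup_left h x

theorem exists_first_jump (hbot : IsBot (c 0)) (htop : ∃ n, IsTop (c n))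
    (hlm : ∀ i, IsLeftModularElement (c i)) {x y : L} (hxy : x < y) :
    ∃ i, y ⊓ c i ≤ x ∧ ¬ y ⊓ c (i + 1) ≤ x ∧ ¬ y ⊓ c (i + 1) ≤ c i ∧ ¬ c (i + 1) ≤ x ⊔ c i := by
  obtain ⟨i, h1, h2⟩ := exists_not_and_succ (p := fun i => ¬ y ⊓ c i ≤ x)
    (not_not.2 (inf_le_right.trans (hbot x)))
    (htop.imp fun n hn h => hxy.not_ge ((le_inf le_rfl (hn y)).trans h))
  rw [not_not] at h1
  refine ⟨i, h1, h2, fun h => h2 ((le_inf inf_le_left h).trans h1), fun h => h2 ?_⟩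
  calc y ⊓ c (i + 1) ≤ (x ⊔ c i) ⊓ y := le_inf (inf_le_right.trans h) inf_le_left
    _ = x ⊔ y ⊓ c i := by rw [hlm _ x y hxy.le, inf_comm]
    _ ≤ x := sup_le le_rfl h1

end LeftModular

/-- A weakly increasing chain of left modular elements from `0` to `1`, such that every step
of the chain passes at most one join-irreducible and at most one meet-irreducible element. -/
structure TrimChain {L : Type u} [Lattice L] (c : ℕ → L) : Prop where
  mono : Monotone c
  bot : IsBot (c 0)
  top : ∃ n, IsTop (c n)
  leftModular : ∀ i, IsLeftModularElement (c i)
  joinIrr_unique : ∀ i (j j' : joinIrr L), (j : L) ≤ c (i + 1) → ¬ (j : L) ≤ c i →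
    (j' : L) ≤ c (i + 1) → ¬ (j' : L) ≤ c i → j = j'
  meetIrr_unique : ∀ i (m m' : meetIrr L), c i ≤ m → ¬ c (i + 1) ≤ m →
    c i ≤ m' → ¬ c (i + 1) ≤ m' → m = m'

/-- The irreducibles `j` and `m` are passed by the `i`-th step of the chain `c`. -/
structure Step {L : Type u} [Lattice L] (c : ℕ → L) (i : ℕ) (j : joinIrr L) (m : meetIrr L) :
    Prop where
  join_le : (j : L) ≤ c (i + 1)
  not_join_le : ¬ (j : L) ≤ c i
  le_meet : c i ≤ m
  not_le_meet : ¬ c (i + 1) ≤ m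

/-! ### The pairing defined by a trim chain. -/

section TrimChain

variable {L : Type u} [Lattice L] {c : ℕ → L}

theorem Step.join_le_meet (hc : TrimChain c) {i i' : ℕ} {j j' : joinIrr L} {m m' : meetIrr L}
    (h : Step c i j m) (h' : Step c i' j' m') (hi : i < i') : (j : L) ≤ m' :=
  h.join_le.trans ((hc.mono hi).trans h'.le_meet)

theorem Step.index_eq_of_join (hc : TrimChain c) {i i' : ℕ} {j : joinIrr L} {m m' : meetIrr L}
    (h : Step c i j m) (h' : Step c i' j m') : i = i' := by
  rcases lt_trichotomy i i' with h1 | h1 | h1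
  · exact absurd (h.join_le.trans (hc.mono h1)) h'.not_join_le
  · exact h1
  · exact absurd (h'.join_le.trans (hc.mono h1)) h.not_join_le

theorem Step.index_eq_of_meet (hc : TrimChain c) {i i' : ℕ} {j j' : joinIrr L} {m : meetIrr L}
    (h : Step c i j m) (h' : Step c i' j' m) : i = i' := by
  rcases lt_trichotomy i i' with h1 | h1 | h1
  · exact absurd ((hc.mono h1).trans h'.le_meet) h.not_le_meet
  · exact h1
  · exact absurd ((hc.mono h1).trans h.le_meet) h'.not_le_meet

theorem Step.join_eq (hc : TrimChain c) {i : ℕ} {j j' : joinIrr L} {m m' : meetIrr L}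
    (h : Step c i j m) (h' : Step c i j' m') : j = j' :=
  hc.joinIrr_unique i j j' h.join_le h.not_join_le h'.join_le h'.not_join_le

theorem Step.meet_eq (hc : TrimChain c) {i : ℕ} {j j' : joinIrr L} {m m' : meetIrr L}
    (h : Step c i j m) (h' : Step c i j' m') : m = m' :=
  hc.meetIrr_unique i m m' h.le_meet h.not_le_meet h'.le_meet h'.not_le_meet

theorem Step.le_index (hc : TrimChain c) {i i' : ℕ} {j j' : joinIrr L} {m m' : meetIrr L}
    (h : Step c i j m) (h' : Step c i' j' m') (hn : ¬ (j : L) ≤ m') : i' ≤ i :=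
  not_lt.1 fun hi => hn (h.join_le_meet hc h' hi)

theorem Step.meet_eq_of_join (hc : TrimChain c) {i i' : ℕ} {j : joinIrr L} {m m' : meetIrr L}
    (h : Step c i j m) (h' : Step c i' j m') : m = m' := by
  obtain rfl := h.index_eq_of_join hc h'
  exact h.meet_eq hc h'

theorem Step.eq_kappa (hc : TrimChain c) {κ : joinIrr L ≃ meetIrr L}
    (hκ : ∀ j, ∃ i, Step c i j (κ j)) {i : ℕ} {j : joinIrr L} {m : meetIrr L}
    (h : Step c i j m) : m = κ j := by
  obtain ⟨i', h'⟩ := hκ j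
  exact h.meet_eq_of_join hc h'

/-- Since `j ≰ κ' j`, the step of `κ' j` is no later than that of `j`. An injection that never moves
to a later step is the identity, by induction on the step. -/
theorem TrimChain.isPairing_unique (hc : TrimChain c) {κ κ' : joinIrr L ≃ meetIrr L}
    (hκ : ∀ j, ∃ i, Step c i j (κ j)) (h' : IsPairing κ') : κ' = κ := by
  suffices H : ∀ (n : ℕ) (j : joinIrr L), Step c n j (κ j) → κ' j = κ j from
    Equiv.ext fun j => H _ j (hκ j).choose_spec
  intro n
  induction n using Nat.strong_induction_on with
  | _ n ih =>
    intro j hj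
    obtain ⟨k, hk⟩ := κ.surjective (κ' j)
    obtain ⟨i, hi⟩ := hκ k
    have hle : i ≤ n := hj.le_index hc hi (hk ▸ h'.not_le j)
    rcases hle.lt_or_eq with hlt | rfl
    · have h1 : κ' k = κ' j := (ih i hlt k hi).trans hk
      obtain rfl := κ'.injective h1
      exact hk.symm
    · rw [← hk, hi.join_eq hc hj]

variable [Finite L]

/-- Any join-irreducible below `c (i+1)` but not `c i ∨ y` is the single one passed by step `i`,
which already lies below `y`. -/
theorem TrimChain.sup_eq (hc : TrimChain c) {i : ℕ} {y : L} (h1 : y ≤ c (i + 1))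
    (h2 : ¬ y ≤ c i) : c i ⊔ y = c (i + 1) := by
  refine le_antisymm (sup_le (hc.mono i.le_succ) h1) (by_contra fun h => ?_)
  obtain ⟨j, hj1, hj2⟩ := exists_joinIrr_le_not_le h
  obtain ⟨j', hj1', hj2'⟩ := exists_joinIrr_le_not_le h2
  obtain rfl := hc.joinIrr_unique i j j' hj1 (fun h => hj2 (h.trans le_sup_left))
    (hj1'.trans h1) hj2'
  exact hj2 (hj1'.trans le_sup_right)

theorem exists_step_of_not_le {i : ℕ} (h : ¬ c (i + 1) ≤ c i) :
    ∃ j m, Step c i j m := by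
  obtain ⟨j, h1, h2⟩ := exists_joinIrr_le_not_le h
  obtain ⟨m, h3, h4⟩ := exists_meetIrr_ge_not_ge h
  exact ⟨j, m, h1, h2, h3, h4⟩

theorem Step.join_le_iff (hc : TrimChain c) {i : ℕ} {j : joinIrr L} {m : meetIrr L}
    (h : Step c i j m) (y : L) : (j : L) ≤ y ↔ ¬ y ⊓ c (i + 1) ≤ c i := by
  refine ⟨fun h1 h2 => h.not_join_le ((le_inf h1 h.join_le).trans h2), fun h1 => ?_⟩
  obtain ⟨j', h2, h3⟩ := exists_joinIrr_le_not_le h1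
  obtain rfl := hc.joinIrr_unique i j j' h.join_le h.not_join_le (h2.trans inf_le_right) h3
  exact h2.trans inf_le_left

theorem Step.le_meet_iff (hc : TrimChain c) {i : ℕ} {j : joinIrr L} {m : meetIrr L}
    (h : Step c i j m) (y : L) : y ≤ m ↔ ¬ c (i + 1) ≤ y ⊔ c i := by
  refine ⟨fun h1 h2 => h.not_le_meet (h2.trans (sup_le h1 h.le_meet)), fun h1 => ?_⟩
  obtain ⟨m', h2, h3⟩ := exists_meetIrr_ge_not_ge h1
  obtain rfl := hc.meetIrr_unique i m m' h.le_meet h.not_le_meet (le_sup_right.trans h2) h3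
  exact le_sup_left.trans h2

theorem Step.not_le (hc : TrimChain c) {i : ℕ} {j : joinIrr L} {m : meetIrr L}
    (h : Step c i j m) : ¬ (j : L) ≤ m := by
  rw [h.le_meet_iff hc, not_not, sup_comm, hc.sup_eq h.join_le h.not_join_le]

theorem TrimChain.exists_step_joinIrr (hc : TrimChain c) (j : joinIrr L) :
    ∃ i m, Step c i j m := by
  obtain ⟨i, h1, h2⟩ := exists_not_and_succ (p := fun i => (j : L) ≤ c i)
    (fun h => (lowerCover_covBy j).lt.not_ge (h.trans (hc.bot _)))
    (hc.top.imp fun n hn => hn j)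
  obtain ⟨_, m, hm⟩ := exists_step_of_not_le fun h => h1 (h2.trans h)
  exact ⟨i, m, h2, h1, hm.le_meet, hm.not_le_meet⟩

theorem TrimChain.exists_step_meetIrr (hc : TrimChain c) (m : meetIrr L) :
    ∃ i j, Step c i j m := by
  obtain ⟨i, h1, h2⟩ := exists_not_and_succ (p := fun i => ¬ c i ≤ m)
    (not_not.2 (hc.bot _))
    (hc.top.imp fun n hn h => (covBy_upperCover m).lt.not_ge ((hn _).trans h))
  rw [not_not] at h1
  obtain ⟨j, _, hm⟩ := exists_step_of_not_le fun h => h2 (h.trans h1)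
  exact ⟨i, j, hm.join_le, hm.not_join_le, h1, h2⟩

theorem TrimChain.exists_equiv (hc : TrimChain c) :
    ∃ κ : joinIrr L ≃ meetIrr L, ∀ j, ∃ i, Step c i j (κ j) := by
  refine exists_equiv_of_existsUnique (R := fun j m => ∃ i, Step c i j m) (fun j => ?_)
    (fun m => ?_)
  · obtain ⟨i, m, h⟩ := hc.exists_step_joinIrr j
    exact ⟨m, ⟨i, h⟩, fun m' ⟨i', h'⟩ => h'.meet_eq_of_join hc h⟩
  · obtain ⟨i, j, h⟩ := hc.exists_step_meetIrr m
    refine ⟨j, ⟨i, h⟩, fun j' ⟨i', h'⟩ => ?_⟩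
    obtain rfl := h'.index_eq_of_meet hc h
    exact h'.join_eq hc h

theorem TrimChain.labelsCovers (hc : TrimChain c) {κ : joinIrr L ≃ meetIrr L}
    (hκ : ∀ j, ∃ i, Step c i j (κ j)) : LabelsCovers κ where
  not_le j := (hκ j).choose_spec.not_le hc
  existsUnique x y hxy := by
    -- With labels at steps `i < i'`, `j ≤ c i' ≤ κ j'`, so `x ∨ j` avoids `j'` and lies strictly
    -- between `x` and `y`.
    have key : ∀ {i i' : ℕ} {j j' : joinIrr L}, Step c i j (κ j) → Step c i' j' (κ j') →
        x ≤ κ j → (j : L) ≤ y → x ≤ κ j' → (j' : L) ≤ y → ¬ i < i' := by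
      intro i i' j j' h h' h1 h2 h3 h4 hi
      refine hxy.2 (c := x ⊔ j) (left_lt_sup.2 fun h5 => h.not_le hc (h5.trans h1)) ?_
      refine (sup_le hxy.le h2).lt_of_ne fun h5 => h'.not_le hc (h4.trans ?_)
      rw [← h5]
      exact sup_le h3 (h.join_le_meet hc h' hi)
    obtain ⟨i, -, -, h1, h2⟩ := exists_last_jump hc.bot hc.top hc.leftModular hxy.lt
    obtain ⟨j, m, h⟩ := exists_step_of_not_le (c := c) (i := i) fun h' => h2 (h'.trans le_sup_right)
    obtain rfl := h.eq_kappa hc hκ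
    have h3 := (h.le_meet_iff hc x).2 h2
    have h4 := (h.join_le_iff hc y).2 h1
    refine ⟨j, ⟨h3, h4⟩, fun j' ⟨h5, h6⟩ => ?_⟩
    obtain ⟨i', h'⟩ := hκ j'
    obtain rfl : i' = i := le_antisymm (not_lt.1 (key h h' h3 h4 h5 h6))
      (not_lt.1 (key h' h h5 h6 h3 h4))
    exact h'.join_eq hc h

theorem TrimChain.uniquelyPaired (hc : TrimChain c) : UniquelyPaired L := by
  obtain ⟨κ, hκ⟩ := hc.exists_equiv
  exact ⟨κ, (hc.labelsCovers hκ).isPairing, fun _ h => hc.isPairing_unique hκ h⟩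

theorem TrimChain.step_kappa (hc : TrimChain c) (h : UniquelyPaired L) (j : joinIrr L) :
    ∃ i, Step c i j (h.kappa j) := by
  obtain ⟨κ, hκ⟩ := hc.exists_equiv
  rw [hc.isPairing_unique hκ h.isPairing_kappa]
  exact hκ j

/-! ### Intervals of trim lattices -/

/-- The cover of `m'` in `[0, w]` is a cover of `L`. If `j` is its label, then `m' = w ∧ κ j`, since
otherwise `j ≤ m'^* ≤ κ j`; comparing indices places `j` at step `i`. -/
theorem TrimChain.meetIrr_Iic (hc : TrimChain c) {w : L} {i : ℕ} (m' : meetIrr (Set.Iic w))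
    (h1 : w ⊓ c i ≤ (m' : Set.Iic w)) (h2 : ¬ w ⊓ c (i + 1) ≤ (m' : Set.Iic w)) :
    ∃ j m, Step c i j m ∧ (j : L) ≤ w ∧ ((m' : Set.Iic w) : L) = w ⊓ m := by
  obtain ⟨κ, hκ⟩ := hc.exists_equiv
  obtain ⟨j, ⟨h3, h4⟩, -⟩ := (hc.labelsCovers hκ).existsUnique _ _
    (Iic_covBy_iff.1 (covBy_upperCover m'))
  obtain ⟨k, hk⟩ := hκ j
  have h5 : (j : L) ≤ w := h4.trans (upperCover m').2
  have h6 : ((m' : Set.Iic w) : L) = w ⊓ κ j := by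
    refine (le_inf (m' : Set.Iic w).2 h3).eq_of_not_lt fun h => hk.not_le hc ?_
    have := upperCover_le_of_lt (m := m') (z := ⟨w ⊓ κ j, inf_le_left⟩) h
    exact h4.trans (le_trans (b := w ⊓ κ j) this inf_le_right)
  rw [h6] at h1 h2
  have h7 : k < i + 1 := not_le.1 fun h =>
    h2 (le_inf inf_le_left (inf_le_right.trans ((hc.mono h).trans hk.le_meet)))
  have h8 : i ≤ k := not_lt.1 fun h => hk.not_le hc
    ((le_inf h5 (hk.join_le.trans (hc.mono h))).trans (h1.trans inf_le_right))
  obtain rfl : k = i := by omega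
  exact ⟨j, κ j, hk, h5, h6⟩

theorem TrimChain.joinIrr_Ici (hc : TrimChain c) {w : L} {i : ℕ} (j' : joinIrr (Set.Ici w))
    (h1 : ((j' : Set.Ici w) : L) ≤ w ⊔ c (i + 1)) (h2 : ¬ ((j' : Set.Ici w) : L) ≤ w ⊔ c i) :
    ∃ j m, Step c i j m ∧ w ≤ m ∧ ((j' : Set.Ici w) : L) = w ⊔ j := by
  obtain ⟨κ, hκ⟩ := hc.exists_equiv
  obtain ⟨j, ⟨h3, h4⟩, -⟩ := (hc.labelsCovers hκ).existsUnique _ _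
    (Ici_covBy_iff.1 (lowerCover_covBy j'))
  obtain ⟨k, hk⟩ := hκ j
  have h5 : w ≤ κ j := le_trans (lowerCover j').2 h3
  have h6 : w ⊔ j = ((j' : Set.Ici w) : L) := by
    refine (sup_le (j' : Set.Ici w).2 h4).eq_of_not_lt fun h => hk.not_le hc ?_
    have := le_lowerCover_of_lt (j := j') (z := ⟨w ⊔ j, le_sup_left⟩) h
    exact le_trans (le_trans (b := w ⊔ j) le_sup_right this) h3
  rw [← h6] at h1 h2
  have h7 : i < k + 1 := not_le.1 fun h =>
    h2 (sup_le le_sup_left (hk.join_le.trans ((hc.mono h).trans le_sup_right)))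
  have h8 : k ≤ i := not_lt.1 fun h => hk.not_le hc
    ((le_sup_right.trans h1).trans (sup_le h5 ((hc.mono h).trans hk.le_meet)))
  obtain rfl : k = i := by omega
  exact ⟨j, κ j, hk, h5, h6.symm⟩

theorem TrimChain.Iic (hc : TrimChain c) (w : L) :
    TrimChain (fun i => (⟨w ⊓ c i, inf_le_left⟩ : Set.Iic w)) where
  mono _ _ h := inf_le_inf_left w (hc.mono h)
  bot x := inf_le_right.trans (hc.bot (x : L))
  top := hc.top.imp fun n hn x => le_inf x.2 (hn _)
  leftModular i y z hyz := by
    refine Subtype.ext ?_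
    change ((y : L) ⊔ w ⊓ c i) ⊓ (z : L) = (y : L) ⊔ w ⊓ c i ⊓ (z : L)
    have hz : (z : L) ≤ w := z.2
    -- Left modularity of `c i` in `L` is used twice, for `y ≤ w` and for `y ≤ z`.
    rw [inf_comm w, ← hc.leftModular i y w y.2, inf_assoc, inf_assoc, inf_eq_right.2 hz,
      hc.leftModular i y z hyz]
  joinIrr_unique i j j' h1 h2 h3 h4 := by
    have := hc.joinIrr_unique i ((joinIrrIicEquiv w).symm j).1 ((joinIrrIicEquiv w).symm j').1
      (le_trans (b := w ⊓ c (i + 1)) h1 inf_le_right) (fun h => h2 (le_inf j.1.2 h))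
      (le_trans (b := w ⊓ c (i + 1)) h3 inf_le_right) (fun h => h4 (le_inf j'.1.2 h))
    exact (joinIrrIicEquiv w).symm.injective (Subtype.ext this)
  meetIrr_unique i m m' h1 h2 h3 h4 := by
    obtain ⟨j, n, h, -, e⟩ := hc.meetIrr_Iic m h1 h2
    obtain ⟨j', n', h', -, e'⟩ := hc.meetIrr_Iic m' h3 h4
    obtain rfl := h.meet_eq hc h'
    exact Subtype.ext (Subtype.ext (e.trans e'.symm))

theorem TrimChain.Ici (hc : TrimChain c) (w : L) :
    TrimChain (fun i => (⟨w ⊔ c i, le_sup_left⟩ : Set.Ici w)) where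
  mono _ _ h := sup_le_sup_left (hc.mono h) w
  bot x := sup_le x.2 (hc.bot _)
  top := hc.top.imp fun n hn x => le_trans (b := c n) (hn (x : L)) le_sup_right
  leftModular i y z hyz := by
    refine Subtype.ext ?_
    change ((y : L) ⊔ (w ⊔ c i)) ⊓ (z : L) = (y : L) ⊔ (w ⊔ c i) ⊓ (z : L)
    have hy : w ≤ (y : L) := y.2
    rw [hc.leftModular i w z z.2, ← sup_assoc, ← sup_assoc, sup_eq_left.2 hy,
      hc.leftModular i y z hyz]
  joinIrr_unique i j j' h1 h2 h3 h4 := by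
    obtain ⟨n, m, h, -, e⟩ := hc.joinIrr_Ici j h1 h2
    obtain ⟨n', m', h', -, e'⟩ := hc.joinIrr_Ici j' h3 h4
    obtain rfl := h.join_eq hc h'
    exact Subtype.ext (Subtype.ext (e.trans e'.symm))
  meetIrr_unique i m m' h1 h2 h3 h4 := by
    have := hc.meetIrr_unique i ((meetIrrIciEquiv w).symm m).1 ((meetIrrIciEquiv w).symm m').1
      (le_trans (b := w ⊔ c i) le_sup_right h1) (fun h => h2 (sup_le m.1.2 h))
      (le_trans (b := w ⊔ c i) le_sup_right h3) (fun h => h4 (sup_le m'.1.2 h))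
    exact (meetIrrIciEquiv w).symm.injective (Subtype.ext this)

theorem TrimChain.lowerCompatible (hc : TrimChain c) (w : L) (h : UniquelyPaired L)
    (h' : UniquelyPaired (Set.Iic w)) : LowerCompatible h w h' := by
  refine lowerCompatible_of_kappa_eq h w h' fun j => ?_
  obtain ⟨i, hi⟩ := (hc.Iic w).step_kappa h' (joinIrrIicEquiv w j)
  obtain ⟨j₁, m, hs, -, e⟩ := hc.meetIrr_Iic _ hi.le_meet hi.not_le_meet
  obtain rfl : j₁ = j.1 := hc.joinIrr_unique i _ _ hs.join_le hs.not_join_le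
    (le_trans (b := w ⊓ c (i + 1)) hi.join_le inf_le_right)
    (fun h => hi.not_join_le (le_inf j.2 h))
  rw [e, hs.eq_kappa hc (hc.step_kappa h)]

theorem TrimChain.upperCompatible (hc : TrimChain c) (w : L) (h : UniquelyPaired L)
    (h' : UniquelyPaired (Set.Ici w)) : UpperCompatible h w h' := by
  refine upperCompatible_of_kappa_symm_eq h w h' fun m => ?_
  obtain ⟨i, hi⟩ := (hc.Ici w).step_kappa h' (h'.kappa.symm (meetIrrIciEquiv w m))
  rw [Equiv.apply_symm_apply] at hi
  obtain ⟨j, m₁, hs, -, e⟩ := hc.joinIrr_Ici _ hi.join_le hi.not_join_le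
  obtain rfl : m₁ = m.1 := hc.meetIrr_unique i _ _ hs.le_meet hs.not_le_meet
    (le_trans (b := w ⊔ c i) le_sup_right hi.le_meet)
    (fun h => hi.not_le_meet (sup_le m.2 h))
  rw [e, hs.eq_kappa hc (hc.step_kappa h), Equiv.symm_apply_apply]

/-- Use the step leaving `0`. There `j ≤ y` means `y ∧ c (i+1) ≠ 0` and `y ≤ m` means `c (i+1) ≰ y`;
by `sup_eq` these are complementary. -/
theorem TrimChain.exists_primePair [Nontrivial L] (hc : TrimChain c) :
    ∃ j₀ m₀ : L, IsPrimePair j₀ m₀ := by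
  obtain ⟨i, h1, h2⟩ := exists_not_and_succ (p := fun i => ¬ IsBot (c i)) (not_not.2 hc.bot)
    (hc.top.imp fun n hn h => by
      obtain ⟨x, y, hxy⟩ := exists_pair_ne L
      exact hxy (le_antisymm ((hn x).trans (h y)) ((hn y).trans (h x))))
  rw [not_not] at h1
  obtain ⟨j, m, h⟩ := exists_step_of_not_le (c := c) (i := i) fun h => h2 fun x => h.trans (h1 x)
  refine ⟨j, m, isPrimePair_of_le_iff fun y => ?_⟩
  rw [h.le_meet_iff hc, h.join_le_iff hc, not_not, sup_eq_left.2 (h1 y)]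
  refine ⟨fun h3 => by_contra fun h4 => h3 ?_, fun h3 h4 => h.not_join_le (h.join_le.trans ?_)⟩
  · rw [← hc.sup_eq inf_le_right h4]
    exact sup_le (h1 y) inf_le_left
  · exact (le_inf h4 le_rfl).trans h3

/-! ### Independence of label sets -/

/-- The jump from `y ∧ y'` to `x` gives `k` at a step `≥ i'`. Any `z` between them with `k ≰ z` lies
below `κ k`. Were `k ≰ y`, `k` would label `y ⋖ x` and equal `j`, whose step is too early. So `k ≤
y`, hence `k ≰ y'`, and `k` is the label `j'` of `y' ⋖ x`. -/
theorem TrimChain.down_join_le (hc : TrimChain c) {κ : joinIrr L ≃ meetIrr L}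
    (hκ : ∀ j, ∃ i, Step c i j (κ j)) {x y y' : L} {i i' : ℕ} {j j' : joinIrr L}
    (h : Step c i j (κ j)) (h' : Step c i' j' (κ j')) (hi : i < i') (hy : y ⋖ x) (hy' : y' ⋖ x)
    (h1 : y ≤ κ j) (h2 : (j : L) ≤ x) (h3 : y' ≤ κ j') (h4 : (j' : L) ≤ x) : (j' : L) ≤ y := by
  have hlab := (hc.labelsCovers hκ).existsUnique
  obtain ⟨l, hl1, hl2, hl3, hl4⟩ := exists_last_jump hc.bot hc.top hc.leftModular
    (inf_le_left.trans_lt hy.lt : y ⊓ y' < x)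
  obtain ⟨k, m, hk⟩ := exists_step_of_not_le (c := c) (i := l) fun h => hl4 (h.trans le_sup_right)
  obtain rfl := hk.eq_kappa hc hκ
  have hkx : (k : L) ≤ x := (hk.join_le_iff hc x).2 hl3
  have hwk : y ⊓ y' ≤ κ k := (hk.le_meet_iff hc _).2 hl4
  have hil : i' ≤ l := by
    by_contra hlt
    refine h'.not_le hc (h4.trans (hl2.trans (sup_le (inf_le_right.trans h3) ?_)))
    exact (hc.mono (by omega)).trans h'.le_meet
  have key : ∀ z, y ⊓ y' ≤ z → z ≤ x → ¬ (k : L) ≤ z → z ≤ κ k := by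
    intro z hwz hzx hkz
    rw [hk.join_le_iff hc, not_not] at hkz
    calc z = (y ⊓ y' ⊔ c (l + 1)) ⊓ z := (inf_eq_right.2 (hzx.trans hl2)).symm
      _ = y ⊓ y' ⊔ z ⊓ c (l + 1) := by rw [hc.leftModular _ _ _ hwz, inf_comm z]
      _ ≤ κ k := sup_le hwk (hkz.trans hk.le_meet)
  have hky : (k : L) ≤ y := by
    by_contra hky
    obtain rfl := (hlab y x hy).unique ⟨key y inf_le_left hy.le hky, hkx⟩ ⟨h1, h2⟩
    have := h.index_eq_of_join hc hk
    omega
  have hky' : ¬ (k : L) ≤ y' := fun hky' => hk.not_le hc ((le_inf hky hky').trans hwk)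
  obtain rfl := (hlab y' x hy').unique ⟨key y' inf_le_right hy'.le hky', hkx⟩ ⟨h3, h4⟩
  exact hky

/-- Dual argument, with the first jump from `x` to `y ∨ y'`, which occurs no later than step `i`. -/
theorem TrimChain.up_le_meet (hc : TrimChain c) {κ : joinIrr L ≃ meetIrr L}
    (hκ : ∀ j, ∃ i, Step c i j (κ j)) {x y y' : L} {i i' : ℕ} {j j' : joinIrr L}
    (h : Step c i j (κ j)) (h' : Step c i' j' (κ j')) (hi : i < i') (hy : x ⋖ y) (hy' : x ⋖ y')
    (h1 : x ≤ κ j) (h2 : (j : L) ≤ y) (h3 : x ≤ κ j') (h4 : (j' : L) ≤ y') : y' ≤ κ j := by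
  have hlab := (hc.labelsCovers hκ).existsUnique
  obtain ⟨l, hl1, hl2, hl3, hl4⟩ := exists_first_jump hc.bot hc.top hc.leftModular
    (hy.lt.trans_le le_sup_left : x < y ⊔ y')
  obtain ⟨k, m, hk⟩ := exists_step_of_not_le (c := c) (i := l) fun h => hl4 (h.trans le_sup_right)
  obtain rfl := hk.eq_kappa hc hκ
  have hkw : (k : L) ≤ y ⊔ y' := (hk.join_le_iff hc _).2 hl3
  have hxk : x ≤ κ k := (hk.le_meet_iff hc _).2 hl4
  have hil : l ≤ i := by
    by_contra hlt
    refine h.not_le hc ((le_inf (h2.trans le_sup_left) ?_).trans (hl1.trans h1))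
    exact h.join_le.trans (hc.mono (by omega))
  have key : ∀ z, x ≤ z → z ≤ y ⊔ y' → ¬ z ≤ κ k → (k : L) ≤ z := by
    intro z hxz hzw hkz
    rw [hk.le_meet_iff hc, not_not] at hkz
    calc (k : L) ≤ (z ⊔ c l) ⊓ (y ⊔ y') := le_inf (hk.join_le.trans hkz) hkw
      _ = z ⊔ (y ⊔ y') ⊓ c l := by rw [hc.leftModular _ _ _ hzw, inf_comm (c l)]
      _ ≤ z := sup_le le_rfl (hl1.trans hxz)
  have hky' : y' ≤ κ k := by
    by_contra hky'
    obtain rfl := (hlab x y' hy').unique ⟨hxk, key y' hy'.le le_sup_right hky'⟩ ⟨h3, h4⟩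
    have := h'.index_eq_of_join hc hk
    omega
  have hky : ¬ y ≤ κ k := fun hky => hk.not_le hc (hkw.trans (sup_le hky hky'))
  obtain rfl := (hlab x y hy).unique ⟨hxk, key y hy.le le_sup_left hky⟩ ⟨h1, h2⟩
  exact hky'

theorem TrimChain.isSemidistrim [Nonempty L] (hc : TrimChain c) : IsSemidistrim L := by
  obtain ⟨κ, hκ⟩ := hc.exists_equiv
  refine isSemidistrim_of_labelsCovers (hc.labelsCovers hκ) (fun _ h => hc.isPairing_unique hκ h)
    (compatiblyDismantlable_of_closed (fun L _ => ∃ c : ℕ → L, TrimChain c)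
      (fun L _ _ _ ⟨c, hc⟩ => hc.uniquelyPaired) (fun L _ _ _ ⟨c, hc⟩ => ?_) L ⟨c, hc⟩) ?_ ?_
  · obtain ⟨j, m, hp⟩ := hc.exists_primePair
    exact ⟨j, m, hp, ⟨_, hc.Ici j⟩, ⟨_, hc.Iic m⟩, hc.upperCompatible j, hc.lowerCompatible m⟩
  · intro x y y' j j' hy hy' hne h1 h2 h3 h4
    obtain ⟨i, h⟩ := hκ j
    obtain ⟨i', h'⟩ := hκ j'
    rcases lt_trichotomy i i' with hi | rfl | hi
    · exact h.join_le_meet hc h' hi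
    · exact absurd (h.join_eq hc h') hne
    · exact (hc.down_join_le hκ h' h hi hy' hy h3 h4 h1 h2).trans h3
  · intro x y y' j j' hy hy' hne h1 h2 h3 h4
    obtain ⟨i, h⟩ := hκ j
    obtain ⟨i', h'⟩ := hκ j'
    rcases lt_trichotomy i i' with hi | rfl | hi
    · exact h.join_le_meet hc h' hi
    · exact absurd (h.join_eq hc h') hne
    · exact h2.trans (hc.up_le_meet hκ h' h hi hy' hy h3 h4 h1 h2)

end TrimChain

/-! ### Trim lattices have a trim chain -/

section OfIsTrim

variable {L : Type u} [Lattice L]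

/-- A maximal chain of a finite lattice, listed in increasing order. -/
theorem exists_enum_of_isMaxChain [Finite L] [Nonempty L] {C : Set L}
    (hC : IsMaxChain (· ≤ ·) C) : ∃ (r : ℕ) (c : ℕ → L), Monotone c ∧ IsBot (c 0) ∧
      IsTop (c r) ∧ (∀ i, c i ∈ C) ∧ (∀ i < r, ¬ c (i + 1) ≤ c i) ∧
      ∀ i y, y ≤ c (i + 1) → ¬ y ≤ c i → c i ⊔ y = c (i + 1) := by
  classical
  have := Fintype.ofFinite L
  let _ : BoundedOrder L := Fintype.toBoundedOrder L
  let F : Flag L := Flag.ofIsMaxChain C hC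
  have hmem : ∀ x : F, (x : L) ∈ C := fun x => x.2
  obtain ⟨r, hr⟩ : ∃ r, Fintype.card F = r + 1 := Nat.exists_eq_succ_of_ne_zero
    (Fintype.card_ne_zero (α := F))
  let e : Fin (r + 1) ≃o F := monoEquivOfFin F hr
  -- Truncating at `r` makes the sequence stay at the top element after the chain ends.
  let c : ℕ → L := fun i => e ⟨min i r, by omega⟩
  have hmono : Monotone c := fun a b hab => e.monotone
    (Fin.mk_le_mk.2 (min_le_min_right r hab))
  have hsurj : ∀ x ∈ C, ∃ i, c i = x := fun x hx => by
    refine ⟨e.symm ⟨x, hx⟩, ?_⟩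
    have h1 : min (e.symm ⟨x, hx⟩ : ℕ) r = e.symm ⟨x, hx⟩ := min_eq_left (by omega)
    change ((e ⟨min (e.symm ⟨x, hx⟩ : ℕ) r, _⟩ : F) : L) = x
    simp only [h1, Fin.eta, OrderIso.apply_symm_apply]
  refine ⟨r, c, hmono, fun x => ?_, fun x => ?_, fun i => hmem _, fun i hi h => ?_,
    fun i y h1 h2 => ?_⟩
  · obtain ⟨i, hi⟩ := hsurj ⊥ hC.bot_mem
    exact (hmono i.zero_le).trans (hi.trans_le bot_le)
  · obtain ⟨i, hi⟩ := hsurj ⊤ hC.top_mem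
    refine le_top.trans (hi.ge.trans (e.monotone (Fin.mk_le_mk.2 ?_)))
    simp
  · have h1 := Fin.mk_le_mk.1 (e.le_iff_le.1 (Subtype.coe_le_coe.1 h))
    omega
  -- `c i ∨ y` lies between consecutive chain elements, so it is comparable to all of `C` and
  -- belongs to it by maximality.
  · have hz : c i ⊔ y ∈ C := by
      by_contra hz
      refine hz (hC.2 (hC.1.insert fun b hb _ => ?_) (Set.subset_insert _ _) ▸
        Set.mem_insert _ _)
      obtain ⟨k, rfl⟩ := hsurj b hb
      rcases le_or_gt k i with hk | hk
      · exact .inr ((hmono hk).trans le_sup_left)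
      · exact .inl ((sup_le (hmono i.le_succ) h1).trans (hmono hk))
    obtain ⟨k, hk⟩ := hsurj _ hz
    refine le_antisymm (sup_le (hmono i.le_succ) h1) ?_
    rw [← hk]
    refine hmono (not_lt.1 fun hlt => h2 ?_)
    exact le_sup_right.trans (hk.ge.trans (hmono (Nat.lt_succ_iff.1 hlt)))

/-- A chain of left modular elements with `r` steps bounds the length of every chain. -/
theorem length_le_of_leftModular {c : ℕ → L} {r : ℕ} (hmono : Monotone c) (hbot : IsBot (c 0))
    (htop : IsTop (c r)) (hlm : ∀ i, IsLeftModularElement (c i))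
    (hcov : ∀ i y, y ≤ c (i + 1) → ¬ y ≤ c i → c i ⊔ y = c (i + 1)) (p : LTSeries L) :
    p.length ≤ r := by
  classical
  -- `S y` records the steps seen below `y`. The jump for `x < y` lies in `S y` but not in `S x`, so
  -- `S` is strictly increasing into subsets of an `r`-element set.
  let S : L → Finset ℕ := fun y => (Finset.range r).filter fun i => ¬ y ⊓ c (i + 1) ≤ c i
  have hS : StrictMono S := by
    intro x y hxy
    obtain ⟨i, -, -, h1, h2⟩ := exists_last_jump hbot ⟨r, htop⟩ hlm hxy
    refine Finset.ssubset_iff_subset_ne.2 ⟨fun k hk => ?_, fun h => ?_⟩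
    · simp only [S, Finset.mem_filter] at hk ⊢
      exact ⟨hk.1, fun h => hk.2 ((inf_le_inf_right _ hxy.le).trans h)⟩
    · have hi : i ∈ S y := Finset.mem_filter.2 ⟨Finset.mem_range.2 (not_le.1 fun hri =>
        h2 ((htop _).trans ((hmono hri).trans le_sup_right))), h1⟩
      rw [← h] at hi
      refine h2 ?_
      rw [← hcov i _ inf_le_right (Finset.mem_filter.1 hi).2]
      exact sup_le le_sup_right (inf_le_left.trans le_sup_left)
  have h1 := LTSeries.head_add_length_le_nat
    (p.map (fun y => (S y).card) fun _ _ h => Finset.card_lt_card (hS h))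
  have h2 : (S p.last).card ≤ r :=
    (Finset.card_filter_le _ _).trans_eq (Finset.card_range r)
  exact (le_add_self.trans h1).trans h2

/-- If each of `r` pairwise disjoint classes is inhabited in a type of cardinality at most `r`,
then each class has at most one element. -/
theorem eq_of_card_le {α : Type*} [Finite α] {r : ℕ} (hcard : Nat.card α ≤ r)
    {p : ℕ → α → Prop} (hex : ∀ i < r, ∃ a, p i a)
    (hdis : ∀ i i' a, p i a → p i' a → i = i') {i : ℕ} {a a' : α} (ha : p i a) (ha' : p i a') :
    a = a' := by
  choose f hf using fun i : Fin r => hex i i.2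
  have hinj : Function.Injective f := fun i i' h =>
    Fin.ext (hdis _ _ _ (hf i) (h ▸ hf i'))
  have hbij := hinj.bijective_of_nat_card_le (by simpa using hcard)
  obtain ⟨k, rfl⟩ := hbij.2 a
  obtain ⟨k', rfl⟩ := hbij.2 a'
  rw [Fin.ext ((hdis _ _ _ (hf k) ha).trans (hdis _ _ _ (hf k') ha').symm)]

/-- The length bound gives `n ≤ r`. Each of the `r` steps passes some irreducible of either kind and
no irreducible is passed twice, so with only `n` of each kind every step passes exactly one. -/
theorem IsTrim.exists_trimChain [Finite L] [Nonempty L] (h : IsTrim L) :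
    ∃ c : ℕ → L, TrimChain c := by
  obtain ⟨n, x, -, -, hx, -, hJ, hM⟩ := h.extremal
  obtain ⟨C, hC, hCl⟩ := h.leftModular
  obtain ⟨r, c, hmono, hbot, htop, hmem, hlt, hcov⟩ := exists_enum_of_isMaxChain hC
  have hlm : ∀ i, IsLeftModularElement (c i) := fun i => hCl _ (hmem i)
  have hnr : n ≤ r := length_le_of_leftModular hmono hbot htop hlm hcov
    ⟨n, x, fun i => (hx i).lt⟩
  refine ⟨c, hmono, hbot, ⟨r, htop⟩, hlm, fun i j j' h1 h2 h3 h4 => ?_,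
    fun i m m' h1 h2 h3 h4 => ?_⟩
  · refine eq_of_card_le (p := fun i (j : joinIrr L) => (j : L) ≤ c (i + 1) ∧ ¬ (j : L) ≤ c i)
      (hJ.trans_le hnr) (fun i hi => exists_joinIrr_le_not_le (hlt i hi)) (fun i i' a ha ha' => ?_)
      ⟨h1, h2⟩ ⟨h3, h4⟩
    by_contra hne
    rcases lt_or_gt_of_ne hne with hi | hi
    · exact ha'.2 (ha.1.trans (hmono hi))
    · exact ha.2 (ha'.1.trans (hmono hi))
  · refine eq_of_card_le (p := fun i (m : meetIrr L) => c i ≤ m ∧ ¬ c (i + 1) ≤ m)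
      (hM.trans_le hnr) (fun i hi => exists_meetIrr_ge_not_ge (hlt i hi)) (fun i i' a ha ha' => ?_)
      ⟨h1, h2⟩ ⟨h3, h4⟩
    by_contra hne
    rcases lt_or_gt_of_ne hne with hi | hi
    · exact ha.2 ((hmono hi).trans ha'.1)
    · exact ha'.2 ((hmono hi).trans ha.1)

end OfIsTrim

end SemidistrimLattice

theorem mainTheorem3 (L : Type u) [Lattice L] [Finite L] [Nonempty L] :
    (SemidistrimLattice.IsSemidistributive L → SemidistrimLattice.IsSemidistrim L) ∧
    (SemidistrimLattice.IsTrim L → SemidistrimLattice.IsSemidistrim L) :=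
  ⟨fun h => h.isSemidistrim, fun h => h.exists_trimChain.elim fun _ hc => hc.isSemidistrim⟩
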